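/- Let $\Sigma$ be a finite alphabet. A word $z$ is an infix of $w$ if $w = pzs$ for some words $p, s$. For $x \in \Sigma^*$ let $P(x) \subseteq \Sigma^*$ denote the set of all infixes of the words $x^p$, $p \in \mathbb{N}$ (so $P(\varepsilon) = \{\varepsilon\}$). Let $L \subseteq \Sigma^*$ be closed under taking infixes and well-quasi-ordered by the infix relation (every infinite sequence $w_0, w_1, \dots$ of words of $L$ has indices $m < n$ such that $w_m$ is an infix of $w_n$). Then the following are equivalent: (i) $L$ is a regular language; (ii) $L$ is recognized by some amalgamation system (defined below); (iii) $L$ is bounded, that is, $L \subseteq w_1^* \cdots w_n^*$ for some words $w_1, \dots, w_n \in \Sigma^*$; (iv) there is a finite set $E \subseteq (\Sigma^*)^3$ such that $L \subseteq \bigcup_{(x,u,y) \in E} P(x)\, u\, P(y)$. Definitions. A subword embedding $f \colon a \to b$ of a word $a = a_1 \cdots a_k$ into a word $b$ is a strictly increasing map from the positions of $a$ to those of $b$ with $a_i = b_{f(i)}$ for all $i$. It determines gap words $G^f_0, \dots, G^f_k$ by $b = G^f_0\, a_1\, G^f_1 \cdots a_k\, G^f_k$, where the displayed $a_i$ is the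 letter of $b$ at position $f(i)$. An amalgamation system over $\Sigma$ consists of a set $R$ of runs, a map $\mathrm{can} \colon R \to (\Sigma \uplus \{\#\})^*$, where $\#$ is a separator symbol, and for all $\rho, \sigma \in R$ a set $E(\rho,\sigma)$ of subword embeddings of $\mathrm{can}(\rho)$ into $\mathrm{can}(\sigma)$ (the admissible ones), such that: 1. identities are admissible, and compositions of admissible embeddings are admissible; 2. $R$ is well-quasi-ordered by the relation "$E(\rho,\sigma) \neq \emptyset$"; 3. for all runs $\rho_0, \rho_1, \rho_2$, all $f \in E(\rho_0,\rho_1)$ and $g \in E(\rho_0,\rho_2)$, and every $0 \le i \le |\mathrm{can}(\rho_0)|$, there are a run $\rho_3$ and embeddings $g' \in E(\rho_1,\rho_3)$, $f' \in E(\rho_2,\rho_3)$ with $g' \circ f = f' \circ g =: h$, with $G^h_j \in \{G^f_j G^g_j,\ G^g_j G^f_j\}$ for every $0 \le j \le |\mathrm{can}(\rho_0)|$, and with $G^h_i = G^f_i G^g_i$. The system recognizes the set of all words obtained from $\mathrm{can}(\rho)$, $\rho \in R$, by erasing $\#$. -/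

import Mathlib

universe u v

/-- A language is downward closed for the infix relation if it contains every infix (contiguous
factor) of each of its words. -/
def InfixDownwardClosed {α : Type u} (L : Language α) : Prop :=
  ∀ w ∈ L, ∀ z : List α, z <:+: w → z ∈ L

/-- A language is infix-wqo if every infinite sequence `w 0, w 1, …` of its words has indices
`m < n` such that `w m` is an infix of `w n`. -/
def InfixWQO {α : Type u} (L : Language α) : Prop :=
  WellQuasiOrdered (fun w z : {w : List α // w ∈ L} => w.1 <:+: z.1)

/-- `L` is bounded if `L ⊆ w₁* ⋯ wₙ*` for some finite list of words `w₁, …, wₙ`. -/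
def BoundedLanguage {α : Type u} (L : Language α) : Prop :=
  ∃ ws : List (List α), L ≤ (ws.map fun w => KStar.kstar ({w} : Language α)).prod

/-- The language of all infixes of the powers `x ^ p`, `p ∈ ℕ`. -/
def InfPeriodChain {α : Type u} (x : List α) : Language α :=
  {w | ∃ p : ℕ, w <:+: (List.replicate p x).flatten}

/-- A subword embedding of `x` into `y`: a strictly increasing, letter-preserving map from the
positions of `x` to the positions of `y`. -/
@[ext]
structure SubwordEmb {β : Type u} (x y : List β) where
  pos : Fin x.length ↪o Fin y.length
  get_eq : ∀ i, x.get i = y.get (pos i)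

namespace SubwordEmb

variable {β : Type u} {x y z : List β}

/-- The identity embedding. -/
def id (x : List β) : SubwordEmb x x where
  pos := RelEmbedding.refl _
  get_eq _ := rfl

/-- The composition "first `f`, then `g`". -/
def trans (f : SubwordEmb x y) (g : SubwordEmb y z) : SubwordEmb x z where
  pos := f.pos.trans g.pos
  get_eq i := (f.get_eq i).trans (g.get_eq (f.pos i))

/-- The (0-based) position of `y` at which the `i`-th gap word starts: right after the image of the
`i`-th letter of `x`, or the beginning of `y` if `i = 0`. -/
def gapStart (f : SubwordEmb x y) (i : Fin (x.length + 1)) : ℕ :=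
  if h : i.val = 0 then 0 else (f.pos ⟨i.val - 1, by omega⟩).val + 1

/-- The (0-based) position of `y` before which the `i`-th gap word stops: the image of the
`(i+1)`-st letter of `x`, or the end of `y` if `i = |x|`. -/
def gapStop (f : SubwordEmb x y) (i : Fin (x.length + 1)) : ℕ :=
  if h : i.val < x.length then (f.pos ⟨i.val, h⟩).val else y.length

/-- The `i`-th gap word of `f`, `0 ≤ i ≤ |x|`, in the decomposition
`y = gap 0 · x₁ · gap 1 · x₂ ⋯ x_k · gap k` with `k = |x|`. -/
def gap (f : SubwordEmb x y) (i : Fin (x.length + 1)) : List β :=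
  (y.take (f.gapStop i)).drop (f.gapStart i)

end SubwordEmb

/-- An amalgamation system over the alphabet `α`. Canonical decompositions are words over `α`
extended by a separator symbol, here `none : Option α`. -/
structure AmalgamationSystem (α : Type u) where
  /-- The set of runs. -/
  Run : Type v
  /-- The canonical decomposition of a run. -/
  can : Run → List (Option α)
  /-- The admissible embeddings between two runs. -/
  E : (ρ σ : Run) → Set (SubwordEmb (can ρ) (can σ))
  /-- Identities are admissible. -/
  id_mem : ∀ ρ, SubwordEmb.id (can ρ) ∈ E ρ ρ
  /-- Admissible embeddings compose. -/
  trans_mem : ∀ {ρ σ τ} (f : SubwordEmb (can ρ) (can σ)) (g : SubwordEmb (can σ) (can τ)),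
    f ∈ E ρ σ → g ∈ E σ τ → f.trans g ∈ E ρ τ
  /-- Runs are well-quasi-ordered by the existence of an admissible embedding. -/
  wqo : WellQuasiOrdered fun ρ σ => (E ρ σ).Nonempty
  /-- Concatenative amalgamation. -/
  amalgamation : ∀ (ρ₀ ρ₁ ρ₂ : Run), ∀ f ∈ E ρ₀ ρ₁, ∀ g ∈ E ρ₀ ρ₂,
    ∀ i : Fin ((can ρ₀).length + 1),
      ∃ ρ₃ : Run, ∃ g' ∈ E ρ₁ ρ₃, ∃ f' ∈ E ρ₂ ρ₃,
        f.trans g' = g.trans f' ∧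
        (∀ j : Fin ((can ρ₀).length + 1),
          (f.trans g').gap j = f.gap j ++ g.gap j ∨ (f.trans g').gap j = g.gap j ++ f.gap j) ∧
        (f.trans g').gap i = f.gap i ++ g.gap i

namespace AmalgamationSystem

/-- The yield of a run: its canonical decomposition with all separators erased. -/
def yieldRun {α : Type u} (S : AmalgamationSystem.{u, v} α) (ρ : S.Run) : List α :=
  (S.can ρ).reduceOption

/-- The language recognized by the system. -/
def language {α : Type u} (S : AmalgamationSystem.{u, v} α) : Language α :=
  Set.range S.yieldRun

end AmalgamationSystem

/-! Everything rests on a fact about a fixed period p. Cut out the factor spanned by two consecutive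
violations of p in a word of L. It has exactly two violations, at 0 and at their distance n, and
length n + p + 1, so one such factor is an infix of another only if their lengths agree.
Well-quasi-ordering therefore bounds n (`exists_mismatch_distance_bound`), and a long factor of
period p must keep that period up to the beginning or the end of the word
(`exists_periodic_factor_bound`).

(i) to (ii): an embedding that respects the states of an automaton has loops as gap words, and loops
at one state can be concatenated (`SubwordEmb.exists_amalgam`). Higman's lemma on state-annotated
words gives the well-quasi-order.

(ii) to (iii): amalgamation makes the gap words at a fixed place a language closed under
concatenation. If it contains v ≠ ε, it contains x v^(N+1) x for each of its words x, which forces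
the period |v| on x. So gap languages are bounded, and finitely many runs embed into all others.

(iii) to (iv): in a product of powers, each long block extends its period to the left or to the
right, which leaves two periodic ends around a short core (`exists_periodicSplit_of_prod`).

(iv) to (i): words of L have the form s x^k y z^l q with finitely many choices of (s, x, y, z, q),
and raising k or l gives a larger word for the infix order. By Dickson's lemma, finitely many
forbidden infixes cut L out of a regular language (`isRegular_of_periodicSplit`). -/

section

open List

variable {α : Type u}

/-- Every subset of a well-quasi-order has a finite basis. -/
theorem WellQuasiOrdered.exists_finset_basis {A : Type*} {r : A → A → Prop}
    (h : WellQuasiOrdered r) (P : A → Prop) :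
    ∃ B : Finset A, (∀ b ∈ B, P b) ∧ ∀ a, P a → ∃ b ∈ B, r b a := by
  by_contra! hcon
  obtain ⟨f, -, hf⟩ := exists_seq_of_forall_finset_exists P (fun a b => ¬ r a b) hcon
  obtain ⟨m, n, hmn, hr⟩ := h f
  exact hf m n hmn hr

/-! ### Violations of a period -/

namespace List

/-- The word `w` violates the period `p` at the index `i`. -/
def PeriodMismatch (p : ℕ) (w : List α) (i : ℕ) : Prop :=
  i + p < w.length ∧ w[i]? ≠ w[i + p]?

theorem hasPeriod_iff_forall_not_mismatch {p : ℕ} {w : List α} :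
    w.HasPeriod p ↔ ∀ i, ¬ PeriodMismatch p w i := by
  rw [hasPeriod_iff_getElem?]
  refine forall_congr' fun i => ?_
  unfold PeriodMismatch
  constructor
  · intro h ⟨h1, h2⟩
    exact h2 (h (by omega))
  · intro h hi
    by_contra hne
    exact h ⟨by omega, hne⟩

theorem periodMismatch_append_append {p : ℕ} {a z b : List α} {k : ℕ}
    (hk : k + p < z.length) :
    PeriodMismatch p (a ++ z ++ b) (a.length + k) ↔ PeriodMismatch p z k := by
  unfold PeriodMismatch
  have h1 : (a ++ z ++ b)[a.length + k]? = z[k]? := by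
    rw [append_assoc, getElem?_append_right (by omega), getElem?_append_left (by omega)]
    congr 1; omega
  have h2 : (a ++ z ++ b)[a.length + k + p]? = z[k + p]? := by
    rw [append_assoc, getElem?_append_right (by omega), getElem?_append_left (by omega)]
    congr 1; omega
  rw [h1, h2]
  simp only [length_append]
  constructor
  · rintro ⟨-, h⟩; exact ⟨hk, h⟩
  · rintro ⟨-, h⟩; exact ⟨by omega, h⟩

end List

/-- In an infix-closed infix-wqo language, the distance between consecutive violations of a given
period is bounded: the factors delimited by such violations form an antichain. -/
theorem exists_mismatch_distance_bound {L : Language α} (hdown : InfixDownwardClosed L)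
    (hwqo : InfixWQO L) (p : ℕ) :
    ∃ N, ∀ w ∈ L, ∀ i j, i < j → PeriodMismatch p w i → PeriodMismatch p w j →
      (∀ k, i < k → k < j → ¬ PeriodMismatch p w k) → j ≤ i + N := by
  by_contra! hcon
  -- Unbounded distances give factors of strictly increasing length, each with violations exactly at
  -- 0 and n.
  obtain ⟨f, hf, hlt⟩ := exists_seq_of_forall_finset_exists
    (fun z : {w : List α // w ∈ L} => ∃ n, 0 < n ∧ z.1.length = n + p + 1 ∧
      ∀ k, PeriodMismatch p z.1 k ↔ k = 0 ∨ k = n)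
    (fun x y => x.1.length < y.1.length) (by
      intro s _
      obtain ⟨w, hw, i, j, hij, hi, hj, hk, hN⟩ := hcon (s.sup fun x => x.1.length)
      obtain ⟨a, z, b, rfl, ha, hz⟩ : ∃ a z b, w = a ++ z ++ b ∧ a.length = i ∧
          z.length = j - i + p + 1 := by
        refine ⟨w.take i, (w.drop i).take (j - i + p + 1), (w.drop i).drop (j - i + p + 1), ?_, ?_, ?_⟩
        · rw [append_assoc, take_append_drop, take_append_drop]
        · have := hi.1; simp; omega
        · have := hj.1; simp; omega
      refine ⟨⟨z, hdown _ hw _ ⟨a, b, rfl⟩⟩, ⟨j - i, by omega, hz, fun k => ?_⟩, fun x hx => ?_⟩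
      · change PeriodMismatch p z k ↔ _
        constructor
        · intro h
          have h1 := h.1
          have h' := (periodMismatch_append_append (a := a) (b := b) h1).2 h
          by_contra! hne
          exact hk _ (by omega) (by omega) h'
        · rintro (rfl | rfl)
          · exact (periodMismatch_append_append (a := a) (b := b) (by omega)).1 (by simpa [ha] using hi)
          · refine (periodMismatch_append_append (a := a) (b := b) (by omega)).1 ?_
            rwa [show a.length + (j - i) = j by omega]
      · have : x.1.length ≤ s.sup fun x => x.1.length :=
          Finset.le_sup (f := fun x : {w : List α // w ∈ L} => x.1.length) hx
        simp only; omega)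
  obtain ⟨m, n, hmn, a, b, hab⟩ := hwqo f
  have hlen := hlt m n hmn
  obtain ⟨k, hk, hkl, hkm⟩ := hf m
  obtain ⟨l, hl, hll, hlm⟩ := hf n
  -- The violations 0 and k of `f m` move to |a| and |a| + k in `f n`, where only 0 and l are
  -- available. Hence k = l, against the increasing lengths.
  have h0 := (periodMismatch_append_append (a := a) (b := b) (by omega)).2 ((hkm 0).2 (.inl rfl))
  have h1 := (periodMismatch_append_append (a := a) (b := b) (by omega)).2 ((hkm k).2 (.inr rfl))
  rw [hab, hlm] at h0 h1
  omega

/-- In an infix-closed infix-wqo language, a long periodic factor extends periodically to one of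
the two ends of the word. -/
theorem exists_periodic_factor_bound {L : Language α} (hdown : InfixDownwardClosed L)
    (hwqo : InfixWQO L) (p : ℕ) :
    ∃ N, ∀ a b c : List α, a ++ b ++ c ∈ L → b.HasPeriod p → N < b.length →
      (a ++ b).HasPeriod p ∨ (b ++ c).HasPeriod p := by
  classical
  obtain ⟨N, hN⟩ := exists_mismatch_distance_bound hdown hwqo p
  -- A violation compares letters at distance p, so b of period p excludes only its first |b| - p
  -- indices.
  refine ⟨N + p, fun a b c hmem hb hlen => ?_⟩
  by_contra! hcon
  simp only [hasPeriod_iff_forall_not_mismatch, not_forall, not_not] at hcon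
  obtain ⟨⟨i, hi⟩, j, hj⟩ := hcon
  set w := a ++ b ++ c with hw
  rw [hasPeriod_iff_forall_not_mismatch] at hb
  have hwa : ∀ i, i + p < (a ++ b).length →
      (PeriodMismatch p w i ↔ PeriodMismatch p (a ++ b) i) := fun i hi => by
    simpa [hw] using periodMismatch_append_append (a := []) (z := a ++ b) (b := c) hi
  have hwc : ∀ i, i + p < (b ++ c).length →
      (PeriodMismatch p w (a.length + i) ↔ PeriodMismatch p (b ++ c) i) := fun i hi => by
    simpa [hw] using periodMismatch_append_append (a := a) (z := b ++ c) (b := []) hi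
  have hwb : ∀ k, a.length ≤ k → k + p < a.length + b.length → ¬ PeriodMismatch p w k := by
    intro k hk1 hk2 h
    obtain ⟨k, rfl⟩ := Nat.exists_eq_add_of_le hk1
    exact hb k ((periodMismatch_append_append (by omega)).1 h)
  have hi' := (hwa i hi.1).2 hi
  have hj' := (hwc j hj.1).2 hj
  have hi1 := hi.1
  have hj1 := hj.1
  simp only [length_append] at hi1 hj1
  have hia : i < a.length := by
    by_contra h; exact hwb i (by omega) (by omega) hi'
  -- The first violation from |a| on and the last one before |a| are consecutive, and their distance
  -- exceeds |b| - p.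
  have hex : ∃ k, a.length ≤ k ∧ PeriodMismatch p w k := ⟨_, by omega, hj'⟩
  have hj2 := Nat.find_spec hex
  have hj3 := fun k => @Nat.find_min _ _ hex k
  generalize Nat.find hex = j0 at hj2 hj3
  have hQ : ∃ k ≤ a.length, PeriodMismatch p w k ∧ k < a.length := ⟨i, by omega, hi', hia⟩
  have hi2 := Nat.findGreatest_spec (P := fun k => PeriodMismatch p w k ∧ k < a.length)
    hQ.choose_spec.1 hQ.choose_spec.2
  have hi3 := fun k => Nat.findGreatest_is_greatest (k := k) (n := a.length)
    (P := fun k => PeriodMismatch p w k ∧ k < a.length)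
  generalize Nat.findGreatest (fun k => PeriodMismatch p w k ∧ k < a.length) a.length = i0
    at hi2 hi3
  have := hN w hmem i0 j0 (by omega) hi2.1 hj2.2 fun k hk1 hk2 h => by
    rcases lt_or_ge k a.length with hka | hka
    · exact hi3 k hk1 hka.le ⟨h, hka⟩
    · exact hj3 k hk2 ⟨hka, h⟩
  have : a.length + b.length ≤ j0 + p := by
    by_contra hh
    exact hwb j0 hj2.1 (by omega) hj2.2
  omega

/-! ### Periodic words as powers with a remainder -/

theorem List.IsPrefix.exists_eq_replicate_flatten_append {x : List α} (hx : x ≠ []) :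
    ∀ {v : List α}, v <+: x ++ v → ∃ (k : ℕ) (q : List α),
      v = (replicate k x).flatten ++ q ∧ q <+: x := by
  intro v
  induction hn : v.length using Nat.strong_induction_on generalizing v with
  | _ n ih =>
    intro h
    rcases prefix_or_prefix_of_prefix h (prefix_append x v) with h1 | ⟨v', rfl⟩
    · exact ⟨0, v, by simp, h1⟩
    · have : 0 < x.length := length_pos_of_ne_nil hx
      obtain ⟨k, q, hv, hq⟩ := ih v'.length (by simp at hn; omega) rfl
        ((prefix_append_right_inj x).1 h)
      exact ⟨k + 1, q, by rw [replicate_succ, flatten_cons, append_assoc, ← hv], hq⟩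

/-- A word of period `p` is a power of a word of length at most `p`, followed by a prefix of it. -/
theorem List.HasPeriod.exists_eq_append_prefix {v : List α} {p : ℕ} (hp : 0 < p)
    (h : v.HasPeriod p) : ∃ (x : List α) (k : ℕ) (q : List α), x.length ≤ p ∧
      v = (replicate k x).flatten ++ q ∧ q <+: x := by
  rcases eq_or_ne v [] with rfl | hv
  · exact ⟨[], 0, [], by simp, by simp, by simp⟩
  · have : v.take p ≠ [] := by simp; exact ⟨by omega, hv⟩
    obtain ⟨k, q, h1, h2⟩ := IsPrefix.exists_eq_replicate_flatten_append this h
    exact ⟨_, k, q, by simp, h1, h2⟩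

theorem List.HasPeriod.reverse {v : List α} {p : ℕ} (h : v.HasPeriod p) :
    v.reverse.HasPeriod p := by
  rw [hasPeriod_iff_getElem?] at h ⊢
  intro i hi
  rw [length_reverse] at hi
  rw [getElem?_reverse (by omega), getElem?_reverse (by omega), h (v.length - 1 - (i + p)) (by omega)]
  congr 1; omega

/-- A word of period `p` is a suffix of a word of length at most `p`, followed by a power of it. -/
theorem List.HasPeriod.exists_eq_suffix_append {v : List α} {p : ℕ} (hp : 0 < p)
    (h : v.HasPeriod p) : ∃ (s x : List α) (k : ℕ), x.length ≤ p ∧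
      v = s ++ (replicate k x).flatten ∧ s <:+ x := by
  obtain ⟨x, k, q, hx, hv, hq⟩ := h.reverse.exists_eq_append_prefix hp
  refine ⟨q.reverse, x.reverse, k, by simpa using hx, ?_, reverse_suffix.2 hq⟩
  rw [← reverse_reverse v, hv]
  simp [reverse_flatten]

theorem List.hasPeriod_replicate_flatten (x : List α) (k : ℕ) :
    ((replicate k x).flatten).HasPeriod x.length := by
  rcases k with _ | k
  · simp
  · unfold HasPeriod
    have : take x.length (replicate (k + 1) x).flatten = x := by
      rw [replicate_succ, flatten_cons, take_left]
    rw [this]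
    refine ⟨x, ?_⟩
    rw [← flatten_concat, ← flatten_cons]
    congr 1
    rw [← replicate_succ', ← replicate_succ]

theorem List.HasPeriod.exists_mem_infPeriodChain {v : List α} {p : ℕ} (hp : 0 < p)
    (h : v.HasPeriod p) : ∃ x : List α, x.length ≤ p ∧ v ∈ InfPeriodChain x := by
  obtain ⟨x, k, q, hx, rfl, t, ht⟩ := h.exists_eq_append_prefix hp
  refine ⟨x, hx, k + 1, [], t, ?_⟩
  rw [replicate_succ', flatten_concat, ← ht]
  simp

/-- For empty x the length is not a positive period and 1 takes its place, hence the bound |x| + 1.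
-/
theorem InfPeriodChain.hasPeriod {x v : List α} (h : v ∈ InfPeriodChain x) :
    ∃ p ≤ x.length + 1, 0 < p ∧ v.HasPeriod p := by
  obtain ⟨k, hk⟩ := h
  have hper := (hasPeriod_replicate_flatten x k).infix hk
  rcases x.length.eq_zero_or_pos with h0 | h0
  · refine ⟨1, by omega, by omega, ?_⟩
    rw [length_eq_zero_iff] at h0
    subst h0
    have : v = [] := by simpa using hk
    simp [this]
  · exact ⟨_, by omega, h0, hper⟩

/-! ### Closure properties of regular languages, by counting left quotients -/

namespace Language

theorem IsRegular.of_forall_leftQuotient_mem {L : Language α} {F : Set (Language α)}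
    (hF : F.Finite) (h : ∀ w, L.leftQuotient w ∈ F) : L.IsRegular :=
  .of_finite_range_leftQuotient (hF.subset (Set.range_subset_iff.2 h))

theorem isRegular_zero : (0 : Language α).IsRegular :=
  .of_forall_leftQuotient_mem (Set.finite_singleton 0) fun _ => rfl

theorem isRegular_top : (⊤ : Language α).IsRegular :=
  .of_forall_leftQuotient_mem (Set.finite_singleton ⊤) fun _ => rfl

theorem isRegular_singleton (x : List α) : ({x} : Language α).IsRegular := by
  refine .of_forall_leftQuotient_mem
    (F := insert 0 ((fun w => ({x} : Language α).leftQuotient w) '' {w | w ∈ x.inits}))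
    ((x.inits.finite_toSet.image _).insert _) fun w => ?_
  by_cases hw : w <+: x
  · exact .inr ⟨w, by simpa using hw, rfl⟩
  · refine .inl (Language.ext fun z => ⟨fun hz => (hw ⟨z, hz⟩).elim, fun hz => (notMem_zero z hz).elim⟩)

/-- The quotient of L * M by w is (w⁻¹L) M together with all v⁻¹M for which w = uv and u ∈ L.
Finitely many quotients of L and M leave finitely many such combinations. -/
theorem IsRegular.mul {L M : Language α} (hL : L.IsRegular) (hM : M.IsRegular) :
    (L * M).IsRegular := by
  refine .of_forall_leftQuotient_mem
    (F := Set.image2 (fun A S => A * M + sSup S) (Set.range L.leftQuotient)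
      (𝒫 (Set.range M.leftQuotient)))
    (hL.finite_range_leftQuotient.image2 _ hM.finite_range_leftQuotient.powerset) fun w => ?_
  refine ⟨_, ⟨w, rfl⟩, {K | ∃ u v, u ∈ L ∧ u ++ v = w ∧ K = M.leftQuotient v}, ?_, ?_⟩
  · rintro _ ⟨u, v, -, -, rfl⟩
    exact ⟨v, rfl⟩
  · ext z
    rw [mem_add, mem_mul, mem_leftQuotient, mem_mul]
    constructor
    · rintro (⟨a, ha, b, hb, rfl⟩ | ⟨_, ⟨u, v, hu, rfl, rfl⟩, hz⟩)
      · exact ⟨w ++ a, ha, b, hb, by simp⟩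
      · exact ⟨u, hu, v ++ z, hz, by simp⟩
    · rintro ⟨a, ha, b, hb, hab⟩
      rcases append_eq_append_iff.1 hab with ⟨c, rfl, rfl⟩ | ⟨c, rfl, rfl⟩
      · exact .inr ⟨_, ⟨a, c, ha, rfl, rfl⟩, hb⟩
      · exact .inl ⟨c, ha, b, hb, rfl⟩

/-- For w ≠ ε the quotient is the union of the v⁻¹L over all w = uv with u ∈ L*, followed by L*. -/
theorem IsRegular.kstar {L : Language α} (hL : L.IsRegular) : (KStar.kstar L).IsRegular := by
  refine .of_forall_leftQuotient_mem
    (F := insert (KStar.kstar L) ((fun S => sSup S * KStar.kstar L) '' 𝒫 (Set.range L.leftQuotient)))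
    ((hL.finite_range_leftQuotient.powerset.image _).insert _) fun w => ?_
  rcases eq_or_ne w [] with rfl | hw
  · exact .inl rfl
  refine .inr ⟨{K | ∃ u v, u ∈ KStar.kstar L ∧ u ++ v = w ∧ K = L.leftQuotient v}, ?_, ?_⟩
  · rintro _ ⟨u, v, -, -, rfl⟩
    exact ⟨v, rfl⟩
  · ext z
    rw [mem_leftQuotient, mem_mul]
    constructor
    · rintro ⟨a, ⟨_, ⟨u, v, hu, rfl, rfl⟩, ha⟩, b, hb, rfl⟩
      obtain ⟨us, rfl, hus⟩ := mem_kstar.1 hu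
      obtain ⟨bs, rfl, hbs⟩ := mem_kstar.1 hb
      refine mem_kstar.2 ⟨us ++ (v ++ a) :: bs, by simp, ?_⟩
      intro y hy
      rcases mem_append.1 hy with hy | hy
      · exact hus y hy
      · rcases mem_cons.1 hy with rfl | hy
        · exact ha
        · exact hbs y hy
    · intro h
      obtain ⟨ys, hys, hL⟩ := mem_kstar.1 h
      clear h
      -- Walk through the factors of the word up to the border between w and z: `us` holds the
      -- factors already passed, and w is now the nonempty part left before the border.
      suffices ∀ (us : List (List α)) (w : List α), (∀ y ∈ us, y ∈ L) → w ≠ [] →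
          w ++ z = ys.flatten → ∃ a ∈ sSup {K | ∃ u v, u ∈ KStar.kstar L ∧
            u ++ v = us.flatten ++ w ∧ K = L.leftQuotient v}, ∃ b ∈ KStar.kstar L, a ++ b = z by
        simpa using this [] w (by simp) hw hys
      clear hys hw w
      induction ys with
      | nil => intro us w _ hw h; simp at h; exact (hw h.1).elim
      | cons y ys ih =>
        intro us w hus hw h
        rw [flatten_cons] at h
        have hyL : y ∈ L := hL y (by simp)
        have hysL : ∀ y ∈ ys, y ∈ L := fun x hx => hL x (by simp [hx])
        rcases append_eq_append_iff.1 h with ⟨c, rfl, rfl⟩ | ⟨c, rfl, h'⟩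
        · exact ⟨c, ⟨_, ⟨us.flatten, w, join_mem_kstar hus, rfl, rfl⟩, hyL⟩, _,
            join_mem_kstar hysL, rfl⟩
        -- If the border is the end of y, stop here, with ε in y⁻¹L; going on would lose w ≠ ε.
        · rcases eq_or_ne c [] with rfl | hc
          · refine ⟨[], ⟨_, ⟨us.flatten, y, join_mem_kstar hus, by simp, rfl⟩, ?_⟩, _,
              join_mem_kstar hysL, by simpa using h'⟩
            change y ++ [] ∈ L
            rwa [append_nil]
          · have := ih hysL (us ++ [y]) c (by
              intro x hx
              rcases mem_append.1 hx with hx | hx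
              · exact hus x hx
              · rw [mem_singleton.1 hx]; exact hyL) hc h'.symm
            simpa using this

theorem IsRegular.biSup_finset {ι : Type*} (s : Finset ι) {f : ι → Language α}
    (h : ∀ i ∈ s, (f i).IsRegular) : (⨆ i ∈ s, f i).IsRegular := by
  classical
  induction s using Finset.induction_on with
  | empty => rw [show (⨆ i ∈ (∅ : Finset ι), f i) = 0 by simp; rfl]; exact isRegular_zero
  | insert a s ha ih =>
    rw [Finset.iSup_insert]
    exact (h a (by simp)).add (ih fun i hi => h i (by simp [hi]))

end Language

/-! ### Subword embeddings and their gap words -/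

namespace SubwordEmb

variable {β : Type u} {x y z : List β}

theorem ext_pos_val {f g : SubwordEmb x y} (h : ∀ i, (f.pos i).val = (g.pos i).val) : f = g :=
  SubwordEmb.ext (RelEmbedding.ext fun i => Fin.ext (h i))

/-- The embedding of the empty word into itself. -/
def nilEmb : SubwordEmb ([] : List β) [] := id []

/-- Add a letter in front of the target word only. -/
def skip (b : β) (f : SubwordEmb x y) : SubwordEmb x (b :: y) where
  pos := f.pos.trans (Fin.succOrderEmb _)
  get_eq i := f.get_eq i

/-- Add the same letter in front of both words. -/
def keep (a : β) (f : SubwordEmb x y) : SubwordEmb (a :: x) (a :: y) where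
  pos := OrderEmbedding.ofStrictMono
    (Fin.cons (α := fun _ => Fin (y.length + 1)) 0 fun i => (f.pos i).succ) (by
      intro i j hij
      induction j using Fin.cases with
      | zero => exact absurd hij (Fin.not_lt_zero i)
      | succ j =>
        induction i using Fin.cases with
        | zero => exact Fin.succ_pos _
        | succ i => exact Fin.succ_lt_succ_iff.2 (f.pos.lt_iff_lt.2 (Fin.succ_lt_succ_iff.1 hij)))
  get_eq i := by
    induction i using Fin.cases with
    | zero => rfl
    | succ i => exact f.get_eq i

/-- Subword embeddings are generated by `nilEmb`, `skip` and `keep`. -/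
inductive Generated : ∀ {x y : List β}, SubwordEmb x y → Prop
  | nil : Generated nilEmb
  | skip (b : β) {x y : List β} {f : SubwordEmb x y} : Generated f → Generated (skip b f)
  | keep (a : β) {x y : List β} {f : SubwordEmb x y} : Generated f → Generated (keep a f)

theorem get_cons_of_pos (b : β) (y : List β) (j : Fin (b :: y).length) (h : 0 < j.val)
    (h' : j.val - 1 < y.length) : (b :: y).get j = y.get ⟨j.val - 1, h'⟩ := by
  rcases j with ⟨_ | j, hj⟩
  · simp at h
  · rfl

/-- Either the first letter of the target is missed, or it is the image of the first letter of the
source. Inductions along this alternative change gap words only at the front. -/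
theorem generated : ∀ {x y : List β} (f : SubwordEmb x y), Generated f := by
  intro x y
  induction y generalizing x with
  | nil =>
    intro f
    cases x with
    | nil =>
      have : f = nilEmb := ext_pos_val fun i => i.elim0
      exact this ▸ .nil
    | cons a x => exact (f.pos ⟨0, by simp⟩).elim0
  | cons b y ih =>
    intro f
    by_cases h : ∀ i, 0 < (f.pos i).val
    · let g : SubwordEmb x y :=
        { pos := OrderEmbedding.ofStrictMono
            (fun i => ⟨(f.pos i).val - 1, by have := (f.pos i).2; simp at this; have := h i; omega⟩)
            (fun i j hij => by
              have h1 : (f.pos i).val < (f.pos j).val := f.pos.lt_iff_lt.2 hij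
              have := h i
              simp only [Fin.mk_lt_mk]; omega)
          get_eq := fun i => (f.get_eq i).trans (get_cons_of_pos b y _ (h i) _) }
      have : f = skip b g := ext_pos_val fun i => by
        have := h i
        change _ = (f.pos i).val - 1 + 1; omega
      rw [this]; exact .skip b (ih g)
    · push Not at h
      obtain ⟨i, hi⟩ := h
      cases x with
      | nil => exact i.elim0
      | cons a x =>
        have h0 : (f.pos ⟨0, by simp⟩).val = 0 := by
          have : f.pos ⟨0, by simp⟩ ≤ f.pos i := f.pos.le_iff_le.2 (Nat.zero_le _)
          have : (f.pos ⟨0, by simp⟩).val ≤ (f.pos i).val := this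
          omega
        have hs : ∀ i : Fin x.length, 0 < (f.pos i.succ).val := fun i => by
          have : f.pos ⟨0, by simp⟩ < f.pos i.succ := f.pos.lt_iff_lt.2 (Fin.succ_pos i)
          have : (f.pos ⟨0, by simp⟩).val < (f.pos i.succ).val := this
          omega
        obtain rfl : a = b := by
          have := f.get_eq ⟨0, by simp⟩
          simpa only [get_eq_getElem, h0, getElem_cons_zero] using this
        let g : SubwordEmb x y :=
          { pos := OrderEmbedding.ofStrictMono
              (fun i => ⟨(f.pos i.succ).val - 1, by
                have := (f.pos i.succ).2; simp at this; have := hs i; omega⟩)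
              (fun i j hij => by
                have h1 : (f.pos i.succ).val < (f.pos j.succ).val :=
                  f.pos.lt_iff_lt.2 (Fin.succ_lt_succ_iff.2 hij)
                have := hs i
                simp only [Fin.mk_lt_mk]; omega)
            get_eq := fun i => (f.get_eq i.succ).trans (get_cons_of_pos a y _ (hs i) _) }
        have : f = keep a g := ext_pos_val fun i => by
          rcases i with ⟨_ | i, hi⟩
          · exact h0
          · have := hs ⟨i, by simpa using hi⟩
            change _ = (f.pos (Fin.succ ⟨i, _⟩)).val - 1 + 1
            rw [Nat.sub_add_cancel this]; rfl
        rw [this]; exact .keep a (ih g)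

theorem skip_trans_keep (b : β) (f : SubwordEmb x y) (g : SubwordEmb y z) :
    (skip b f).trans (keep b g) = skip b (f.trans g) := rfl

theorem trans_skip (b : β) (f : SubwordEmb x y) (g : SubwordEmb y z) :
    f.trans (skip b g) = skip b (f.trans g) := rfl

theorem keep_trans_keep (a : β) (f : SubwordEmb x y) (g : SubwordEmb y z) :
    (keep a f).trans (keep a g) = keep a (f.trans g) :=
  ext_pos_val fun i => by rcases i with ⟨_ | i, hi⟩ <;> rfl

theorem gap_nilEmb (i) : (nilEmb : SubwordEmb ([] : List β) []).gap i = [] := by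
  simp [gap]

theorem gap_nil (f : SubwordEmb [] y) (i) : f.gap i = y := by
  have : i = (0 : Fin 1) := Subsingleton.elim (α := Fin 1) i 0
  subst this
  simp [gap, gapStart, gapStop]

theorem gapStop_skip (b : β) (f : SubwordEmb x y) (i) :
    (skip b f).gapStop i = f.gapStop i + 1 := by
  unfold gapStop
  split <;> rfl

theorem gapStart_skip (b : β) (f : SubwordEmb x y) {i : Fin (x.length + 1)} (hi : i.val ≠ 0) :
    (skip b f).gapStart i = f.gapStart i + 1 := by
  simp only [gapStart, dif_neg hi]
  rfl

theorem gapStart_zero (f : SubwordEmb x y) : f.gapStart 0 = 0 := rfl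

theorem gapStop_keep_succ (a : β) (f : SubwordEmb x y) (i : Fin (x.length + 1)) :
    (keep a f).gapStop i.succ = f.gapStop i + 1 := by
  unfold gapStop
  by_cases h : i.val < x.length
  · rw [dif_pos h]
    exact dif_pos (Nat.succ_lt_succ h)
  · rw [dif_neg h]
    exact dif_neg fun h' => h (Nat.lt_of_succ_lt_succ h')

theorem gapStart_keep_succ (a : β) (f : SubwordEmb x y) (i : Fin (x.length + 1)) :
    (keep a f).gapStart i.succ = f.gapStart i + 1 := by
  rcases i with ⟨_ | i, hi⟩ <;> rfl

theorem gap_skip_zero (b : β) (f : SubwordEmb x y) : (skip b f).gap 0 = b :: f.gap 0 := by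
  simp [gap, gapStart_zero, gapStop_skip]

theorem gap_skip_of_ne (b : β) (f : SubwordEmb x y) {i} (hi : i ≠ 0) :
    (skip b f).gap i = f.gap i := by
  simp [gap, gapStart_skip b f fun h => hi (Fin.ext h), gapStop_skip]

theorem gap_keep_zero (a : β) (f : SubwordEmb x y) : (keep a f).gap 0 = [] := by
  simp only [gap, gapStart_zero, show (keep a f).gapStop 0 = 0 from rfl, take_zero, drop_nil]

theorem gap_keep_succ (a : β) (f : SubwordEmb x y) (i : Fin (x.length + 1)) :
    (keep a f).gap i.succ = f.gap i := by
  simp [gap, gapStart_keep_succ, gapStop_keep_succ]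

theorem gap_infix (f : SubwordEmb x y) (i) : f.gap i <:+: y :=
  (drop_suffix _ _).isInfix.trans (take_prefix _ _).isInfix

/-- An embedding of `a :: x` splits off the first gap word and the image of `a`. -/
theorem exists_eq_gap_zero_append (a : β) {x y : List β} (f : SubwordEmb (a :: x) y) :
    ∃ (y' : List β) (f' : SubwordEmb x y'), y = f.gap 0 ++ a :: y' ∧
      ∀ i : Fin (x.length + 1), f.gap i.succ = f'.gap i := by
  induction y with
  | nil => exact (f.pos ⟨0, by simp⟩).elim0
  | cons b y ih =>
    cases generated f with
    | @skip _ _ _ g _ =>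
      obtain ⟨y', f', h1, h2⟩ := ih g
      refine ⟨y', f', by rw [gap_skip_zero, cons_append, ← h1], fun i => ?_⟩
      rw [gap_skip_of_ne _ _ (Fin.succ_ne_zero i), h2]
    | @keep _ _ _ g _ => exact ⟨y, g, by rw [gap_keep_zero]; rfl, gap_keep_succ a g⟩

/-! ### State-respecting embeddings and their amalgamation -/

section Respects

variable {σ : Type*} (δ : σ → β → σ)

/-- The embedding `f` matches positions at which the automaton with transition function `δ` is in
the same state, when it reads `x` from the state `s` and `y` from the state `t`; the final states
have to agree as well. -/
def Respects (s t : σ) (f : SubwordEmb x y) : Prop :=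
  (∀ i, (x.take i.val).foldl δ s = (y.take (f.pos i).val).foldl δ t) ∧ x.foldl δ s = y.foldl δ t

theorem respects_id (s : σ) : Respects δ s s (id x) := ⟨fun _ => rfl, rfl⟩

variable {δ}

theorem Respects.trans {s t r : σ} {f : SubwordEmb x y} {g : SubwordEmb y z}
    (hf : Respects δ s t f) (hg : Respects δ t r g) : Respects δ s r (f.trans g) :=
  ⟨fun i => (hf.1 i).trans (hg.1 (f.pos i)), hf.2.trans hg.2⟩

theorem respects_nilEmb {s t : σ} :
    Respects δ s t (nilEmb : SubwordEmb ([] : List β) []) ↔ s = t :=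
  ⟨fun h => h.2, fun h => ⟨fun i => i.elim0, h⟩⟩

theorem respects_keep {s t : σ} {a : β} {f : SubwordEmb x y} :
    Respects δ s t (keep a f) ↔ s = t ∧ Respects δ (δ s a) (δ t a) f := by
  constructor
  · intro h
    exact ⟨show s = t from h.1 ⟨0, Nat.succ_pos _⟩, fun i => h.1 i.succ, h.2⟩
  · rintro ⟨rfl, h⟩
    refine ⟨fun i => ?_, h.2⟩
    rcases i with ⟨_ | i, hi⟩
    · rfl
    · exact h.1 ⟨i, by simpa using hi⟩

end Respects

/-- Two embeddings of the same word are amalgamated by concatenating their gap words; if both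
respect the states of an automaton, so do the two embeddings into the amalgam. -/
theorem exists_amalgam {σ : Type*} (δ : σ → β → σ) {x y₁ y₂ : List β} (f : SubwordEmb x y₁)
    (g : SubwordEmb x y₂) :
    ∃ (y₃ : List β) (g' : SubwordEmb y₁ y₃) (f' : SubwordEmb y₂ y₃),
      f.trans g' = g.trans f' ∧ (∀ j, (f.trans g').gap j = f.gap j ++ g.gap j) ∧
      ∀ s t r, Respects δ s t f → Respects δ s r g →
        (r = s → Respects δ t t g' ∧ Respects δ r t f') ∧
        (f.gap 0 = [] → Respects δ t r g' ∧ Respects δ r r f') := by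
  -- The two state clauses are the two stages of a gap. While the gap of f is read, y₂ waits at r =
  -- s and the amalgam is in the state t of y₁. Once it is exhausted, the gap of g is read and the
  -- amalgam is in the state r of y₂.
  induction hn : y₁.length + y₂.length using Nat.strong_induction_on generalizing x y₁ y₂ with
  | _ n ih =>
  have left_skip : ∀ {x y₁ y₂ : List β} (b : β) (f : SubwordEmb x y₁) (g : SubwordEmb x y₂),
      (y₁.length + 1 + y₂.length = n) →
      ∃ (y₃ : List β) (g' : SubwordEmb (b :: y₁) y₃) (f' : SubwordEmb y₂ y₃),
      (skip b f).trans g' = g.trans f' ∧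
      (∀ j, ((skip b f).trans g').gap j = (skip b f).gap j ++ g.gap j) ∧
      ∀ s t r, Respects δ s t (skip b f) → Respects δ s r g →
        (r = s → Respects δ t t g' ∧ Respects δ r t f') ∧
        ((skip b f).gap 0 = [] → Respects δ t r g' ∧ Respects δ r r f') := by
    intro x y₁ y₂ b f g hn
    obtain ⟨y₃, g', f', h1, h2, h3⟩ := ih _ (by omega) f g rfl
    refine ⟨b :: y₃, keep b g', skip b f', ?_, fun j => ?_, fun s t r hf hg => ⟨fun hr => ?_, ?_⟩⟩
    · rw [skip_trans_keep, trans_skip, h1]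
    · rw [skip_trans_keep]
      rcases eq_or_ne j 0 with rfl | hj
      · rw [gap_skip_zero, gap_skip_zero, h2, cons_append]
      · rw [gap_skip_of_ne _ _ hj, gap_skip_of_ne _ _ hj, h2]
    · obtain ⟨h4, h5⟩ := (h3 s (δ t b) r hf hg).1 hr
      exact ⟨respects_keep.2 ⟨rfl, h4⟩, h5⟩
    · rw [gap_skip_zero]; intro h; cases h
  have right_skip : ∀ {x y₁ y₂ : List β} (b : β) (f : SubwordEmb x y₁) (g : SubwordEmb x y₂),
      (y₁.length + (y₂.length + 1) = n) → f.gap 0 = [] →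
      (∀ s t, Respects δ s t f → s = t) →
      ∃ (y₃ : List β) (g' : SubwordEmb y₁ y₃) (f' : SubwordEmb (b :: y₂) y₃),
      f.trans g' = (skip b g).trans f' ∧
      (∀ j, (f.trans g').gap j = f.gap j ++ (skip b g).gap j) ∧
      ∀ s t r, Respects δ s t f → Respects δ s r (skip b g) →
        (r = s → Respects δ t t g' ∧ Respects δ r t f') ∧
        (f.gap 0 = [] → Respects δ t r g' ∧ Respects δ r r f') := by
    intro x y₁ y₂ b f g hn hgap hst
    obtain ⟨y₃, g', f', h1, h2, h3⟩ := ih _ (by omega) f g rfl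
    refine ⟨b :: y₃, skip b g', keep b f', ?_, fun j => ?_, fun s t r hf hg => ?_⟩
    · rw [skip_trans_keep, trans_skip, h1]
    · rw [trans_skip]
      rcases eq_or_ne j 0 with rfl | hj
      · rw [gap_skip_zero, gap_skip_zero, h2, hgap]; rfl
      · rw [gap_skip_of_ne _ _ hj, gap_skip_of_ne _ _ hj, h2]
    · obtain ⟨h4, h5⟩ := (h3 s t (δ r b) hf hg).2 hgap
      have h6 : Respects δ t r (skip b g') := h4
      have h7 : Respects δ r r (keep b f') := respects_keep.2 ⟨rfl, h5⟩
      obtain rfl := hst s t hf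
      refine ⟨?_, fun _ => ⟨h6, h7⟩⟩
      rintro rfl
      exact ⟨h6, h7⟩
  cases generated f with
  | @skip b _ _ f _ => exact left_skip b f g hn
  | nil =>
    cases generated g with
    | @skip b _ _ g _ => exact right_skip b nilEmb g hn (gap_nilEmb _) fun _ _ => respects_nilEmb.1
    | nil =>
      refine ⟨[], nilEmb, nilEmb, rfl, fun j => ?_, fun s t r hf hg => ?_⟩
      · rw [show nilEmb.trans nilEmb = (nilEmb : SubwordEmb ([] : List β) []) from rfl, gap_nilEmb]
        rfl
      · simp only [respects_nilEmb] at *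
        subst hf hg
        simp
  | @keep a x y₁ f _ =>
    cases generated g with
    | @skip b _ _ g _ =>
      exact right_skip b (keep a f) g hn (gap_keep_zero a f) fun _ _ h => (respects_keep.1 h).1
    | @keep _ _ y₂ g _ =>
      obtain ⟨y₃, g', f', h1, h2, h3⟩ := ih (y₁.length + y₂.length) (by simp at hn; omega) f g rfl
      refine ⟨a :: y₃, keep a g', keep a f', ?_, fun j => ?_, fun s t r hf hg => ?_⟩
      · rw [keep_trans_keep, keep_trans_keep, h1]
      · rw [keep_trans_keep]
        induction j using Fin.cases with
        | zero => simp only [gap_keep_zero]; rfl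
        | succ j => rw [gap_keep_succ, gap_keep_succ, gap_keep_succ, h2]
      · rw [respects_keep] at hf hg
        obtain ⟨rfl, hf⟩ := hf
        obtain ⟨rfl, hg⟩ := hg
        obtain ⟨h4, h5⟩ := (h3 _ _ _ hf hg).1 rfl
        simp [respects_keep, h4, h5]

/-! ### Well-quasi-ordering by Higman's lemma -/

section Higman

variable {σ : Type*} (δ : σ → β → σ)

/-- The run of an automaton on a word: each letter is paired with the state before it, and the
final state is appended. -/
def annotate (s : σ) : List β → List (σ × Option β)
  | [] => [(s, none)]
  | a :: x => (s, some a) :: annotate (δ s a) x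

theorem annotate_ne_nil (s : σ) (x : List β) : annotate δ s x ≠ [] := by
  cases x <;> simp [annotate]

theorem exists_respects_of_annotate_sublist : ∀ (y x : List β) (s t : σ),
    annotate δ s x <+ annotate δ t y → ∃ f : SubwordEmb x y, Respects δ s t f := by
  intro y
  induction y with
  | nil =>
    intro x s t h
    rcases (sublist_singleton.1 h) with h | h
    · exact (annotate_ne_nil δ s x h).elim
    · cases x with
      | nil => exact ⟨nilEmb, respects_nilEmb.2 (by simpa [annotate] using h)⟩
      | cons a x => simp [annotate] at h
  | cons b y ih =>
    intro x s t h
    cases x with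
    | nil =>
      rw [annotate, annotate, sublist_cons_iff] at h
      rcases h with h | ⟨r, h, -⟩
      · obtain ⟨f, hf⟩ := ih [] s _ h
        exact ⟨skip b f, hf⟩
      · simp at h
    | cons a x =>
      rw [annotate.eq_2, annotate.eq_2, sublist_cons_iff] at h
      rcases h with h | ⟨r, h, hr⟩
      · obtain ⟨f, hf⟩ := ih (a :: x) s _ h
        exact ⟨skip b f, hf⟩
      · simp only [cons.injEq, Prod.mk.injEq, Option.some.injEq] at h
        obtain ⟨⟨rfl, rfl⟩, rfl⟩ := h
        obtain ⟨f, hf⟩ := ih x _ _ hr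
        exact ⟨keep a f, respects_keep.2 ⟨rfl, hf⟩⟩

/-- Over a finite automaton, state-respecting embeddability is a well-quasi-order. -/
theorem wellQuasiOrdered_exists_respects [Finite β] [Finite σ] (s : σ) :
    WellQuasiOrdered fun x y : List β => ∃ f : SubwordEmb x y, Respects δ s s f := by
  intro w
  have h := (Set.partiallyWellOrderedOn_univ_iff.2
    (Finite.wellQuasiOrdered (α := σ × Option β) (· = ·))).partiallyWellOrderedOn_sublistForall₂
  obtain ⟨m, n, hmn, hs⟩ := h fun n => ⟨annotate δ s (w n), fun _ _ => trivial⟩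
  obtain ⟨l, hl, hsub⟩ := sublistForall₂_iff.1 hs
  rw [forall₂_eq_eq_eq] at hl
  subst hl
  exact ⟨m, n, hmn, exists_respects_of_annotate_sublist δ _ _ _ _ hsub⟩

end Higman

end SubwordEmb

/-! ### The amalgamation system of a regular language -/

theorem DFA.foldl_elim_eq_evalFrom {σ : Type*} (M : DFA α σ) (w : List (Option α)) (s : σ) :
    w.foldl (fun s o => o.elim s (M.step s)) s = M.evalFrom s w.reduceOption := by
  induction w generalizing s with
  | nil => rfl
  | cons o w ih =>
    cases o with
    | none => exact ih s
    | some a => exact ih _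

/-- Every regular language is recognized by an amalgamation system: its runs are the words with
separators inserted, and the admissible embeddings are those that respect the states of a finite
automaton. -/
theorem Language.IsRegular.exists_amalgamationSystem [Finite α] {L : Language α}
    (h : L.IsRegular) : ∃ S : AmalgamationSystem.{u, v} α, S.language = L := by
  obtain ⟨σ, _, M, rfl⟩ := h
  -- Separators leave the state unchanged and may occur anywhere, so every word with accepted
  -- erasure is a run, amalgams included. The set is countable and thus has a copy in every
  -- universe.
  let X := {w : List (Option α) // w.reduceOption ∈ M.accepts}
  have : Small.{v} X := Countable.toSmall X
  let e : X ≃ Shrink.{v} X := equivShrink.{v} X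
  let δ : σ → Option α → σ := fun s o => o.elim s (M.step s)
  let S : AmalgamationSystem.{u, v} α :=
    { Run := Shrink.{v} X
      can := fun ρ => (e.symm ρ).1
      E := fun ρ τ => {f | SubwordEmb.Respects δ M.start M.start f}
      id_mem := fun ρ => SubwordEmb.respects_id δ _
      trans_mem := fun f g hf hg => SubwordEmb.Respects.trans hf hg
      wqo := fun ρ =>
        SubwordEmb.wellQuasiOrdered_exists_respects δ M.start fun n => (e.symm (ρ n)).1
      amalgamation := by
        intro ρ₀ ρ₁ ρ₂ f hf g hg i
        obtain ⟨y₃, g', f', h1, h2, h3⟩ := SubwordEmb.exists_amalgam δ f g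
        obtain ⟨hg', hf'⟩ := (h3 _ _ _ hf hg).1 rfl
        obtain ⟨ρ₃, rfl⟩ : ∃ ρ₃ : Shrink.{v} X, (e.symm ρ₃).1 = y₃ := by
          refine ⟨e ⟨y₃, ?_⟩, by simp⟩
          have h4 := (e.symm ρ₁).2
          have h5 := hg'.2
          rw [DFA.mem_accepts, DFA.eval] at h4 ⊢
          rwa [← M.foldl_elim_eq_evalFrom y₃, ← h5, M.foldl_elim_eq_evalFrom]
        exact ⟨ρ₃, g', hg', f', hf', h1, fun j => .inl (h2 j), h2 i⟩ }
  refine ⟨S, Set.Subset.antisymm ?_ fun w hw => ?_⟩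
  · rintro _ ⟨ρ, rfl⟩
    exact (e.symm ρ).2
  · have hr : (w.map some).reduceOption = w := by simp [reduceOption]
    refine ⟨e ⟨w.map some, by rwa [hr]⟩, ?_⟩
    change ((e.symm (e _)).1).reduceOption = w
    rw [Equiv.symm_apply_apply, hr]

/-! ### Bounded languages -/

theorem List.replicate_flatten_mem_kstar (x : List α) (k : ℕ) :
    (replicate k x).flatten ∈ KStar.kstar ({x} : Language α) :=
  Language.mem_kstar.2 ⟨_, rfl, fun _ hy => eq_of_mem_replicate hy⟩

theorem Language.mem_kstar_singleton {x w : List α} :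
    w ∈ KStar.kstar ({x} : Language α) ↔ ∃ k, w = (replicate k x).flatten := by
  constructor
  · intro h
    obtain ⟨l, rfl, hl⟩ := mem_kstar.1 h
    exact ⟨l.length, by rw [← eq_replicate_of_mem hl]⟩
  · rintro ⟨k, rfl⟩
    exact replicate_flatten_mem_kstar x k

theorem Language.mem_biSup_finset {ι : Type*} {s : Finset ι} {f : ι → Language α} {w : List α} :
    w ∈ ⨆ i ∈ s, f i ↔ ∃ i ∈ s, w ∈ f i := by
  simp only [Language.mem_iSup, exists_prop]

namespace BoundedLanguage

theorem mono {L M : Language α} (hM : BoundedLanguage M) (h : L ≤ M) : BoundedLanguage L :=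
  hM.imp fun _ hws => h.trans hws

theorem nil_mem_prod (ws : List (List α)) :
    [] ∈ (ws.map fun w => KStar.kstar ({w} : Language α)).prod := by
  induction ws with
  | nil => exact Language.nil_mem_one
  | cons w ws ih =>
    rw [map_cons, prod_cons]
    exact Language.append_mem_mul (Language.nil_mem_kstar _) ih

theorem mul {L M : Language α} (hL : BoundedLanguage L) (hM : BoundedLanguage M) :
    BoundedLanguage (L * M) := by
  obtain ⟨ws, hws⟩ := hL
  obtain ⟨vs, hvs⟩ := hM
  refine ⟨ws ++ vs, ?_⟩
  rw [map_append, prod_append]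
  rintro _ ⟨a, ha, b, hb, rfl⟩
  exact Language.append_mem_mul (hws ha) (hvs hb)

theorem add {L M : Language α} (hL : BoundedLanguage L) (hM : BoundedLanguage M) :
    BoundedLanguage (L + M) := by
  obtain ⟨ws, hws⟩ := hL
  obtain ⟨vs, hvs⟩ := hM
  refine ⟨ws ++ vs, ?_⟩
  rw [map_append, prod_append]
  rintro a (ha | ha)
  · simpa using! Language.append_mem_mul (hws ha) (nil_mem_prod vs)
  · simpa using! Language.append_mem_mul (nil_mem_prod ws) (hvs ha)

theorem kstar_singleton (w : List α) : BoundedLanguage (KStar.kstar ({w} : Language α)) :=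
  ⟨[w], by simp⟩

theorem singleton (w : List α) : BoundedLanguage ({w} : Language α) :=
  (kstar_singleton w).mono fun x hx => Language.mem_kstar_singleton.2 ⟨1, by
    rw [show x = w from hx]; simp⟩

theorem zero : BoundedLanguage (0 : Language α) :=
  ⟨[], fun _ h => h.elim⟩

theorem biSup_finset {ι : Type*} (s : Finset ι) {f : ι → Language α}
    (h : ∀ i ∈ s, BoundedLanguage (f i)) : BoundedLanguage (⨆ i ∈ s, f i) := by
  classical
  induction s using Finset.induction_on with
  | empty => rw [show (⨆ i ∈ (∅ : Finset ι), f i) = 0 by simp; rfl]; exact zero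
  | insert a s ha ih =>
    rw [Finset.iSup_insert]
    exact (h a (by simp)).add (ih fun i hi => h i (by simp [hi]))

/-- Over a finite alphabet, the words of a given period form a bounded language. -/
theorem hasPeriod [Finite α] {p : ℕ} (hp : 0 < p) :
    BoundedLanguage ({w | w.HasPeriod p} : Set (List α)) := by
  let F := (finite_length_le α p).toFinset
  refine (biSup_finset (F ×ˢ F) fun t _ =>
    (kstar_singleton t.1).mul (singleton t.2)).mono fun w hw => ?_
  obtain ⟨x, k, q, hx, rfl, hq⟩ := HasPeriod.exists_eq_append_prefix hp hw
  refine Language.mem_biSup_finset.2 ⟨(x, q), ?_,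
    Language.append_mem_mul (replicate_flatten_mem_kstar x k) rfl⟩
  simp only [F, Finset.mem_product, Set.Finite.mem_toFinset]
  exact ⟨hx, hq.length_le.trans hx⟩

end BoundedLanguage

/-! ### From amalgamation systems to bounded languages -/

/-- A subset of an infix-closed infix-wqo language that is closed under concatenation consists of
words of one common period. -/
theorem BoundedLanguage.of_append_closed [Finite α] {L M : Language α}
    (hdown : InfixDownwardClosed L) (hwqo : InfixWQO L) (hML : M ≤ L)
    (hM : ∀ x ∈ M, ∀ y ∈ M, x ++ y ∈ M) : BoundedLanguage M := by
  by_cases h : ∃ v ∈ M, v ≠ []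
  · obtain ⟨v, hv, hne⟩ := h
    have hp : 0 < v.length := length_pos_of_ne_nil hne
    obtain ⟨N, hN⟩ := exists_periodic_factor_bound hdown hwqo v.length
    refine (BoundedLanguage.hasPeriod hp).mono fun x hx => ?_
    have hpow : ∀ n, (replicate (n + 1) v).flatten ∈ M := fun n => by
      induction n with
      | zero => simpa using hv
      | succ n ih => rw [replicate_succ, flatten_cons]; exact hM _ hv _ ih
    -- With x on both sides of the power, x inherits the period whichever way it extends.
    rcases hN x (replicate (N + 1) v).flatten x (hML (hM _ (hM _ hx _ (hpow N)) _ hx))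
      (hasPeriod_replicate_flatten v _) (by simp; nlinarith) with h | h
    · exact h.infix (prefix_append _ _).isInfix
    · exact h.infix (suffix_append _ _).isInfix
  · push Not at h
    exact (BoundedLanguage.singleton []).mono h

/-- The erased target lies in D₀ a₁ D₁ ⋯ a_k D_k, where separators contribute ε. Indexing D by ℕ
turns the passage to the tail of x into a shift. -/
theorem SubwordEmb.exists_boundedLanguage_of_gaps (x : List (Option α)) (D : ℕ → Language α)
    (hD : ∀ i, BoundedLanguage (D i)) :
    ∃ X : Language α, BoundedLanguage X ∧ ∀ (y : List (Option α)) (f : SubwordEmb x y),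
      (∀ i, (f.gap i).reduceOption ∈ D i.val) → y.reduceOption ∈ X := by
  induction x generalizing D with
  | nil => exact ⟨D 0, hD 0, fun y f h => by simpa [gap_nil] using h ⟨0, by simp⟩⟩
  | cons a x ih =>
    obtain ⟨X, hX, hmem⟩ := ih (fun i => D (i + 1)) fun i => hD _
    refine ⟨D 0 * ({[a].reduceOption} * X), (hD 0).mul ((BoundedLanguage.singleton _).mul hX),
      fun y f h => ?_⟩
    obtain ⟨y', f', hy, hgap⟩ := exists_eq_gap_zero_append a f
    rw [hy, show f.gap 0 ++ a :: y' = f.gap 0 ++ ([a] ++ y') from rfl, reduceOption_append,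
      reduceOption_append]
    refine Language.append_mem_mul (h 0) (Language.append_mem_mul rfl (hmem y' f' fun i => ?_))
    rw [← hgap]
    exact h i.succ

/-- The erased gap words at a given place of a run of an amalgamation system. -/
def AmalgamationSystem.gapLanguage (S : AmalgamationSystem.{u, v} α) (ρ : S.Run)
    (i : Fin ((S.can ρ).length + 1)) : Language α :=
  {w | ∃ τ, ∃ f ∈ S.E ρ τ, (f.gap i).reduceOption = w}

theorem AmalgamationSystem.boundedLanguage [Finite α] (S : AmalgamationSystem.{u, v} α)
    (hdown : InfixDownwardClosed S.language) (hwqo : InfixWQO S.language) :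
    BoundedLanguage S.language := by
  have hgap : ∀ ρ i, BoundedLanguage (S.gapLanguage ρ i) := fun ρ i => by
    refine .of_append_closed hdown hwqo ?_ ?_
    · rintro _ ⟨τ, f, -, rfl⟩
      exact hdown _ ⟨τ, rfl⟩ _ ((f.gap_infix i).filterMap _)
    · rintro _ ⟨τ₁, f, hf, rfl⟩ _ ⟨τ₂, g, hg, rfl⟩
      obtain ⟨ρ₃, g', hg', -, -, -, -, h⟩ := S.amalgamation ρ τ₁ τ₂ f hf g hg i
      exact ⟨ρ₃, f.trans g', S.trans_mem f g' hf hg', by rw [h, reduceOption_append]⟩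
  have hrun : ∀ ρ, ∃ X : Language α, BoundedLanguage X ∧
      ∀ τ, (S.E ρ τ).Nonempty → S.yieldRun τ ∈ X := fun ρ => by
    obtain ⟨X, hX, h⟩ := SubwordEmb.exists_boundedLanguage_of_gaps (S.can ρ)
      (fun i => if h : i < (S.can ρ).length + 1 then S.gapLanguage ρ ⟨i, h⟩ else 0) fun i => by
        split
        · exact hgap ρ _
        · exact .zero
    refine ⟨X, hX, fun τ ⟨f, hf⟩ => h _ f fun i => ?_⟩
    rw [dif_pos i.2]
    exact ⟨τ, f, hf, rfl⟩
  choose X hX hmem using hrun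
  obtain ⟨B, -, hB⟩ := S.wqo.exists_finset_basis fun _ => True
  refine (BoundedLanguage.biSup_finset B fun ρ _ => hX ρ).mono ?_
  rintro _ ⟨τ, rfl⟩
  obtain ⟨ρ, hρ, h⟩ := hB τ trivial
  exact Language.mem_biSup_finset.2 ⟨ρ, hρ, hmem ρ τ h⟩

/-! ### Periodic splits -/

/-- The word `w` is a product of a periodic word, a word of length at most `K` and another periodic
word, both periods being at most `P`. -/
def PeriodicSplit (P K : ℕ) (w : List α) : Prop :=
  ∃ x y z : List α, w = x ++ y ++ z ∧ (∃ p, 0 < p ∧ p ≤ P ∧ x.HasPeriod p) ∧ y.length ≤ K ∧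
    ∃ p, 0 < p ∧ p ≤ P ∧ z.HasPeriod p

/-- Peel off the blocks b of the product one by one. A short b is absorbed into the core y. A long b
either extends its period to the left, so that x y b becomes the new periodic part with empty core,
or to the right, so that all that remains is periodic and the process stops. -/
theorem exists_periodicSplit_of_prod {L : Language α} (hdown : InfixDownwardClosed L)
    (hwqo : InfixWQO L) (ws : List (List α)) (P K : ℕ) (hP : 0 < P) :
    ∃ P' K', ∀ x y z : List α, (∃ p, 0 < p ∧ p ≤ P ∧ x.HasPeriod p) → y.length ≤ K →
      z ∈ (ws.map fun w => KStar.kstar ({w} : Language α)).prod → x ++ y ++ z ∈ L →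
      PeriodicSplit P' K' (x ++ y ++ z) := by
  induction ws generalizing P K with
  | nil =>
    refine ⟨P, K, fun x y z hx hy hz _ => ⟨x, y, [], ?_, hx, hy, P, hP, le_rfl, by simp⟩⟩
    rw [show z = [] from hz]
  | cons w ws ih =>
    obtain ⟨N, hN⟩ := exists_periodic_factor_bound hdown hwqo w.length
    obtain ⟨P', K', h⟩ := ih (max P w.length) (K + N) (by omega)
    refine ⟨max P' (max P w.length), max K K', fun x y z ⟨p, hp, hpP, hx⟩ hy hz hmem => ?_⟩
    rw [map_cons, prod_cons] at hz
    obtain ⟨b, hb, c, hc, rfl⟩ := Language.mem_mul.1 hz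
    have lift : PeriodicSplit P' K' (x ++ y ++ (b ++ c)) →
        PeriodicSplit (max P' (max P w.length)) (max K K') (x ++ y ++ (b ++ c)) := by
      rintro ⟨x, y, z, h, ⟨p, h1, h2, h3⟩, h4, q, h5, h6, h7⟩
      exact ⟨x, y, z, h, ⟨p, h1, by omega, h3⟩, by omega, q, h5, by omega, h7⟩
    obtain ⟨k, hk⟩ := Language.mem_kstar_singleton.1 hb
    rcases le_or_gt b.length N with hbN | hbN
    · have := h x (y ++ b) c ⟨p, hp, by omega, hx⟩ (by simp; omega) hc (by simpa using hmem)
      exact lift (by simpa using this)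
    · have hw : 0 < w.length := by
        by_contra h0
        have : w = [] := length_eq_zero_iff.1 (by omega)
        subst this
        rw [hk] at hbN
        simp at hbN
      have hper : b.HasPeriod w.length := hk ▸ hasPeriod_replicate_flatten w k
      rcases hN (x ++ y) b c (by simpa using hmem) hper hbN with h' | h'
      · have := h (x ++ y ++ b) [] c ⟨_, hw, by omega, h'⟩ (by simp) hc (by simpa using hmem)
        exact lift (by simpa using this)
      · exact ⟨x, y, b ++ c, rfl, ⟨p, hp, by omega, hx⟩, by omega, _, hw, by omega, h'⟩

theorem BoundedLanguage.exists_periodicSplit {L : Language α} (hdown : InfixDownwardClosed L)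
    (hwqo : InfixWQO L) (h : BoundedLanguage L) : ∃ P K, ∀ w ∈ L, PeriodicSplit P K w := by
  obtain ⟨ws, hws⟩ := h
  obtain ⟨P, K, h⟩ := exists_periodicSplit_of_prod hdown hwqo ws 1 0 one_pos
  exact ⟨P, K, fun w hw => h [] [] w ⟨1, by simp⟩ le_rfl (hws hw) hw⟩

theorem exists_finset_infPeriodChain_of_periodicSplit [Finite α] {L : Language α} {P K : ℕ}
    (h : ∀ w ∈ L, PeriodicSplit P K w) : ∃ E : Finset (List α × List α × List α),
      L ≤ ⨆ t ∈ E, InfPeriodChain t.1 * {t.2.1} * InfPeriodChain t.2.2 := by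
  let F := (finite_length_le α P).toFinset
  refine ⟨F ×ˢ (finite_length_le α K).toFinset ×ˢ F, fun w hw => ?_⟩
  obtain ⟨x, y, z, rfl, ⟨p, hp, hpP, hx⟩, hy, q, hq, hqP, hz⟩ := h w hw
  obtain ⟨x', hx', hxmem⟩ := hx.exists_mem_infPeriodChain hp
  obtain ⟨z', hz', hzmem⟩ := hz.exists_mem_infPeriodChain hq
  refine Language.mem_biSup_finset.2 ⟨(x', y, z'), ?_,
    Language.append_mem_mul (Language.append_mem_mul hxmem rfl) hzmem⟩
  simp only [F, Finset.mem_product, Set.Finite.mem_toFinset]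
  exact ⟨hx'.trans hpP, hy, hz'.trans hqP⟩

theorem exists_periodicSplit_of_finset_infPeriodChain {L : Language α}
    {E : Finset (List α × List α × List α)}
    (hE : L ≤ ⨆ t ∈ E, InfPeriodChain t.1 * {t.2.1} * InfPeriodChain t.2.2) :
    ∃ P K, ∀ w ∈ L, PeriodicSplit P K w := by
  refine ⟨E.sup fun t => max (t.1.length + 1) (t.2.2.length + 1), E.sup fun t => t.2.1.length,
    fun w hw => ?_⟩
  obtain ⟨⟨x, y, z⟩, ht, hw⟩ := Language.mem_biSup_finset.1 (hE hw)
  obtain ⟨_, ⟨v, hv, y', hy', rfl⟩, t, ht', rfl⟩ := hw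
  obtain rfl : y' = y := hy'
  obtain ⟨p, hpx, hp, hvp⟩ := InfPeriodChain.hasPeriod hv
  obtain ⟨q, hqz, hq, htq⟩ := InfPeriodChain.hasPeriod ht'
  have h1 := Finset.le_sup (f := fun t : List α × List α × List α =>
    max (t.1.length + 1) (t.2.2.length + 1)) ht
  have h2 := Finset.le_sup (f := fun t : List α × List α × List α => t.2.1.length) ht
  exact ⟨v, y', t, rfl, ⟨p, hp, by dsimp only at hpx h1; omega, hvp⟩, h2, q, hq,
    by dsimp only at hqz h1; omega, htq⟩

/-! ### Pumped words and regularity -/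

/-- The word `s x ^ k y z ^ l q` for `t = (s, x, y, z, q)`. -/
def pumpedWord (t : List α × List α × List α × List α × List α) (n : ℕ × ℕ) : List α :=
  t.1 ++ (replicate n.1 t.2.1).flatten ++ t.2.2.1 ++ (replicate n.2 t.2.2.2.1).flatten ++ t.2.2.2.2

/-- If x = r s, then s x^(l+1) = (s r)(s x^l): the power grows on the left only. -/
theorem List.suffix_append_replicate_flatten {s x : List α} (h : s <:+ x) {k l : ℕ} (hkl : k ≤ l) :
    s ++ (replicate k x).flatten <:+ s ++ (replicate l x).flatten := by
  induction hkl with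
  | refl => exact suffix_rfl
  | @step l _ ih =>
    refine ih.trans ?_
    obtain ⟨r, rfl⟩ := h
    exact ⟨s ++ r, by simp [replicate_succ]⟩

theorem List.prefix_replicate_flatten_append {q x : List α} (h : q <+: x) {k l : ℕ} (hkl : k ≤ l) :
    (replicate k x).flatten ++ q <+: (replicate l x).flatten ++ q := by
  induction hkl with
  | refl => exact prefix_rfl
  | @step l _ ih =>
    refine ih.trans ?_
    obtain ⟨r, rfl⟩ := h
    exact ⟨r ++ q, by simp [replicate_succ', -replicate_append_replicate]⟩

/-- Since s ends x and q begins z, larger exponents only add letters at the two outer ends and keep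
the core in place. -/
theorem pumpedWord_infix {t : List α × List α × List α × List α × List α} (hs : t.1 <:+ t.2.1)
    (hq : t.2.2.2.2 <+: t.2.2.2.1) {m n : ℕ × ℕ} (h : m ≤ n) :
    pumpedWord t m <:+: pumpedWord t n := by
  obtain ⟨a, ha⟩ := suffix_append_replicate_flatten hs h.1
  obtain ⟨b, hb⟩ := prefix_replicate_flatten_append hq h.2
  refine ⟨a, b, ?_⟩
  unfold pumpedWord
  rw [← ha, append_assoc _ _ t.2.2.2.2, append_assoc _ _ t.2.2.2.2, ← hb]
  simp

theorem isRegular_range_pumpedWord (t : List α × List α × List α × List α × List α) :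
    Language.IsRegular (Set.range (pumpedWord t)) := by
  have : (Set.range (pumpedWord t) : Language α) =
      ({t.1} : Language α) * KStar.kstar ({t.2.1} : Language α) * ({t.2.2.1} : Language α) *
        KStar.kstar ({t.2.2.2.1} : Language α) * ({t.2.2.2.2} : Language α) := by
    refine Set.Subset.antisymm ?_ ?_
    · rintro _ ⟨n, rfl⟩
      exact Language.append_mem_mul (Language.append_mem_mul (Language.append_mem_mul
        (Language.append_mem_mul rfl (replicate_flatten_mem_kstar _ _)) rfl)
        (replicate_flatten_mem_kstar _ _)) rfl
    · rintro _ ⟨_, ⟨_, ⟨_, ⟨_, rfl, _, hk, rfl⟩, _, rfl, rfl⟩, _, hl, rfl⟩, _, rfl, rfl⟩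
      obtain ⟨k, rfl⟩ := Language.mem_kstar_singleton.1 hk
      obtain ⟨l, rfl⟩ := Language.mem_kstar_singleton.1 hl
      exact ⟨(k, l), rfl⟩
  rw [this]
  exact ((((Language.isRegular_singleton _).mul (Language.isRegular_singleton _).kstar).mul
    (Language.isRegular_singleton _)).mul (Language.isRegular_singleton _).kstar).mul
    (Language.isRegular_singleton _)

/-- An infix-closed language of words with a periodic split is regular: it is cut out of a regular
language by finitely many forbidden infixes. -/
theorem isRegular_of_periodicSplit [Finite α] {L : Language α} (hdown : InfixDownwardClosed L)
    {P K : ℕ} (h : ∀ w ∈ L, PeriodicSplit P K w) : L.IsRegular := by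
  classical
  let F := (finite_length_le α P).toFinset
  let T := (F ×ˢ F ×ˢ (finite_length_le α K).toFinset ×ˢ F ×ˢ F).filter
    fun t => t.1 <:+ t.2.1 ∧ t.2.2.2.2 <+: t.2.2.2.1
  have hcover : ∀ w ∈ L, ∃ t ∈ T, ∃ n, pumpedWord t n = w := fun w hw => by
    obtain ⟨x, y, z, rfl, ⟨p, hp, hpP, hx⟩, hy, q, hq, hqP, hz⟩ := h w hw
    obtain ⟨s, x', k, hx', rfl, hs⟩ := hx.exists_eq_suffix_append hp
    obtain ⟨z', l, r, hz', rfl, hr⟩ := hz.exists_eq_append_prefix hq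
    refine ⟨(s, x', y, z', r), ?_, (k, l), by simp [pumpedWord]⟩
    simp only [T, F, Finset.mem_filter, Finset.mem_product, Set.Finite.mem_toFinset]
    exact ⟨⟨(hs.length_le.trans hx').trans hpP, hx'.trans hpP, hy, hz'.trans hqP,
      (hr.length_le.trans hz').trans hqP⟩, hs, hr⟩
  -- Dickson's lemma for the exponents, with equality on the finitely many tuples (s, x, y, z, q).
  have hwqo : WellQuasiOrdered fun a b : T × (ℕ × ℕ) => a.1 = b.1 ∧ a.2 ≤ b.2 :=
    (Finite.wellQuasiOrdered (· = ·)).prod wellQuasiOrdered_le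
  obtain ⟨B, hBL, hB⟩ := hwqo.exists_finset_basis fun a => pumpedWord a.1.1 a.2 ∉ L
  -- A pumped word outside L lies above a basis element with the same tuple, which is one of its
  -- infixes; infix-closedness keeps those infixes out of all words of L.
  have : L = (⨆ t ∈ T, (Set.range (pumpedWord t) : Language α)) ⊓
      (⨆ b ∈ B, ⊤ * {pumpedWord b.1.1 b.2} * ⊤ : Language α)ᶜ := by
    refine Language.ext fun w => ⟨fun hw => ⟨?_, fun hw' => ?_⟩, ?_⟩
    · obtain ⟨t, ht, n, hn⟩ := hcover w hw
      exact Language.mem_biSup_finset.2 ⟨t, ht, n, hn⟩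
    · obtain ⟨b, hb, _, ⟨c, -, _, rfl, rfl⟩, d, -, rfl⟩ := Language.mem_biSup_finset.1 hw'
      exact hBL b hb (hdown _ hw _ ⟨c, d, rfl⟩)
    · rintro ⟨hw, hforb⟩
      obtain ⟨t, ht, n, rfl⟩ := Language.mem_biSup_finset.1 hw
      by_contra hw'
      obtain ⟨⟨⟨t', ht'⟩, m⟩, hb, hbt, hmn⟩ := hB (⟨t, ht⟩, n) hw'
      obtain rfl : t' = t := congrArg Subtype.val hbt
      have ht2 := (Finset.mem_filter.1 ht).2
      obtain ⟨c, d, hcd⟩ := pumpedWord_infix ht2.1 ht2.2 hmn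
      refine hforb (Language.mem_biSup_finset.2 ⟨_, hb, ?_⟩)
      rw [← hcd]
      exact Language.append_mem_mul (Language.append_mem_mul trivial rfl) trivial
  rw [this]
  exact (Language.IsRegular.biSup_finset T fun t _ => isRegular_range_pumpedWord t).inf
    (Language.IsRegular.biSup_finset B fun b _ => (Language.isRegular_top.mul
      (Language.isRegular_singleton _)).mul Language.isRegular_top).compl

end

theorem mainTheorem9 {α : Type u} [Finite α] (L : Language α)
    (hdown : InfixDownwardClosed L) (hwqo : InfixWQO L) :
    List.TFAE [
      L.IsRegular,
      ∃ S : AmalgamationSystem.{u, v} α, S.language = L,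
      BoundedLanguage L,
      ∃ E : Finset (List α × List α × List α),
        L ≤ ⨆ t ∈ E, InfPeriodChain t.1 * {t.2.1} * InfPeriodChain t.2.2] := by
  tfae_have 1 → 2 := fun h => h.exists_amalgamationSystem
  tfae_have 2 → 3 := by
    rintro ⟨S, rfl⟩
    exact S.boundedLanguage hdown hwqo
  tfae_have 3 → 4 := fun h => by
    obtain ⟨P, K, hPK⟩ := h.exists_periodicSplit hdown hwqo
    exact exists_finset_infPeriodChain_of_periodicSplit hPK
  tfae_have 4 → 1 := by
    rintro ⟨E, hE⟩
    obtain ⟨P, K, hPK⟩ := exists_periodicSplit_of_finset_infPeriodChain hE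
    exact isRegular_of_periodicSplit hdown hPK
  tfae_finish
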